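/- For a complex number $q$ with $|q|<1$ write $(a;q)_n=\prod_{k=0}^{n-1}(1-aq^k)$ and $(a;q)_\infty=\prod_{k\ge 0}(1-aq^k)$. Let $\mathcal{P}_4$ be the set of strict partitions $\lambda=(\lambda_1>\lambda_2>\cdots)$ (the empty partition included) such that for consecutive parts $\lambda_i-\lambda_{i+1}\equiv 2 \pmod 4$ if both parts are odd, $\equiv 0\pmod 4$ if both are even, $\equiv 3\pmod 4$ if they have different parity, and such that the smallest part is $\equiv 1$ or $2\pmod 4$. Let $o(\lambda)$ and $e(\lambda)$ be the numbers of odd and even parts of $\lambda$, and $|\lambda|$ the sum of its parts. Let $q\in\mathbb{C}$ with $|q|<1$. Every infinite series below converges absolutely. (1) For all $x,y\in\mathbb{C}$ with $x\neq0$, $1+xq^{2k+1}\ne0$ and $1-yq^{2k+2}\neq0$ for all integers $k\ge0$, $$\sum_{\lambda\in\mathcal{P}_4}x^{o(\lambda)}y^{e(\lambda)}q^{|\lambda|}=\frac{(-xq;q^2)_{\infty}}{(yq^2;q^2)_{\infty}}\left(1+(1+y)\sum_{n=1}^{\infty}\frac{(-1)^n(1-yq^{4n})(y^2q^4;q^4)_{n-1}(-yq/x;q^2)_nx^nq^{3n^2}}{(q^4;q^4)_n(-xq;q^2)_n}\right).$$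 (2) For all $x\in\mathbb{C}$ with $x\ne0$, $$\sum_{\lambda\in\mathcal{P}_4}x^{o(\lambda)}(-1)^{e(\lambda)}q^{|\lambda|}=\sum_{n=0}^{\infty}\frac{(q/x;q^2)_{n}x^nq^{n^{2}}}{(q^4;q^4)_{n}}=\frac{(-xq;q^2)_{\infty}}{(-q^2;q^2)_{\infty}}.$$ (3) In particular, for $x=-1$ one obtains Slater's identity (4): $$\sum_{\lambda\in\mathcal{P}_4}(-1)^{o(\lambda)+e(\lambda)}q^{|\lambda|}=\sum_{n=0}^{\infty}\frac{(-1)^{n}(-q;q^2)_{n}q^{n^2}}{(q^4;q^4)_{n}}=(q;q^2)_{\infty}(q^2;q^4)_{\infty}.$$ -/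

import Mathlib

open Finset

/-- The finite `q`-Pochhammer symbol `(a; q)_n = ∏_{k=0}^{n-1} (1 - a q^k)`. -/
def qPoch (a q : ℂ) (n : ℕ) : ℂ := ∏ k ∈ range n, (1 - a * q ^ k)

/-- The infinite `q`-Pochhammer symbol `(a; q)_∞ = ∏_{k=0}^∞ (1 - a q^k)` (used for `|q| < 1`). -/
noncomputable def qPochInf (a q : ℂ) : ℂ := ∏' k : ℕ, (1 - a * q ^ k)

/-- For `|q| < 1` the product defining `(a; q)_∞` converges, so `qPochInf` is not a junk value. -/
theorem hasProd_qPochInf (a : ℂ) {q : ℂ} (hq : ‖q‖ < 1) :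
    HasProd (fun k : ℕ => 1 - a * q ^ k) (qPochInf a q) := by
  have h : Summable (fun k : ℕ => ‖-(a * q ^ k)‖) := by
    simp only [norm_neg, norm_mul, norm_pow]
    exact (summable_geometric_of_lt_one (norm_nonneg q) hq).mul_left _
  have h2 : Multipliable (fun k : ℕ => 1 - a * q ^ k) := by
    simpa [sub_eq_add_neg] using multipliable_one_add_of_summable h
  exact h2.hasProd

/-- An integer partition `λ` of an arbitrary natural number `|λ|` (the first component). -/
abbrev IntPartition : Type := Σ n : ℕ, n.Partition

namespace IntPartition

/-- The size `|λ|`, i.e. the sum of the parts. -/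
def size (p : IntPartition) : ℕ := p.1

/-- The list of parts `λ₁ ≥ λ₂ ≥ ⋯` in weakly decreasing order. -/
def partList (p : IntPartition) : List ℕ := p.2.parts.sort (· ≥ ·)

/-- `o(λ)`, the number of odd parts. -/
def oddCount (p : IntPartition) : ℕ := p.2.parts.countP (fun a => Odd a)

/-- `e(λ)`, the number of even parts. -/
def evenCount (p : IntPartition) : ℕ := p.2.parts.countP (fun a => Even a)

end IntPartition

/-- The condition on two consecutive parts `a = λ_i`, `b = λ_{i+1}` of a partition in `𝒫₄`. -/
structure P4Gap (a b : ℕ) : Prop where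
  strict : b < a
  odd_odd : Odd a → Odd b → (a : ℤ) - b ≡ 2 [ZMOD 4]
  even_even : Even a → Even b → (a : ℤ) - b ≡ 0 [ZMOD 4]
  mixed : ¬ (Odd a ↔ Odd b) → (a : ℤ) - b ≡ 3 [ZMOD 4]

/-- The class `𝒫₄`: strict partitions satisfying the gap conditions, whose smallest part (if there
is one) is congruent to `1` or `2` modulo `4`. The empty partition belongs to it. -/
def P4 : Set IntPartition :=
  {p | p.partList.IsChain P4Gap ∧
    ∀ s ∈ p.partList.getLast?, s ≡ 1 [MOD 4] ∨ s ≡ 2 [MOD 4]}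

/-- The `n`-th term, `n ≥ 1`, of the series in the transformed form of the generating function. -/
noncomputable def transformedTerm (x y q : ℂ) (n : ℕ) : ℂ :=
  (-1) ^ n * (1 - y * q ^ (4 * n)) * qPoch (y ^ 2 * q ^ 4) (q ^ 4) (n - 1)
      * qPoch (-(y * q / x)) (q ^ 2) n * x ^ n * q ^ (3 * n ^ 2)
    / (qPoch (q ^ 4) (q ^ 4) n * qPoch (-(x * q)) (q ^ 2) n)

open Filter Topology

/-! Give an odd part width 1 and an even part width 2. The conditions defining `P4` say that two
neighbouring parts differ by the sum of their widths plus a nonnegative multiple of 4, and that the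
smallest part is its own width plus such a multiple. A partition is therefore a free word of pairs
(parity, multiple). Peeling off smallest parts gives the product `genFun` for partitions with `n`
parts, and `hasSum_P4` sums over `n`.

With `p = q²`, `b = -xq`, `c = yp`, the `n`-th product is `(c/b; p)_n (-b)^n p^(n choose 2) / (p²;
p²)_n`. For `y = -1` the denominator is `(p; p)_n (c; p)_n` and the series is a `₁φ₁`, summed by
`hasSum_phiTerm`. For general `y`, `1 / (p²; p²)_n` is the `β` side of a Bailey pair relative to `y`
(`sum_baileyAlpha`). Inserting that relation and interchanging sums leaves an inner `₁φ₁` for each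
`r`, and the `α` side is the transformed series (`exists_hasSum_bailey`). The factor `1 + y` is `(1
- y²) / (1 - y)`, cancelled in advance so that `y = 1` is allowed. Slater's product then follows
from Euler's identity. -/

/-! ### Finite and infinite `q`-Pochhammer symbols: splitting and bounds -/

theorem qPoch_zero (a p : ℂ) : qPoch a p 0 = 1 := by simp [qPoch]

theorem qPoch_succ (a p : ℂ) (n : ℕ) : qPoch a p (n + 1) = qPoch a p n * (1 - a * p ^ n) := by
  simp [qPoch, prod_range_succ]

theorem qPoch_add (a p : ℂ) (m n : ℕ) :
    qPoch a p (m + n) = qPoch a p m * qPoch (a * p ^ m) p n := by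
  simp only [qPoch, prod_range_add]
  congr 1
  refine prod_congr rfl fun k _ => ?_
  ring

theorem qPoch_succ' (a p : ℂ) (n : ℕ) : qPoch a p (n + 1) = (1 - a) * qPoch (a * p) p n := by
  rw [add_comm, qPoch_add]
  simp [qPoch]

theorem qPoch_ne_zero {a p : ℂ} (h : ∀ k : ℕ, 1 - a * p ^ k ≠ 0) (n : ℕ) : qPoch a p n ≠ 0 :=
  prod_ne_zero_iff.2 fun k _ => h k

theorem one_sub_ne_zero_of_norm_lt {z : ℂ} (hz : ‖z‖ < 1) : 1 - z ≠ 0 := by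
  intro h
  rw [← sub_eq_zero.1 h] at hz
  simp at hz

theorem one_sub_mul_pow_ne_zero {a p : ℂ} (ha : ‖a‖ < 1) (hp : ‖p‖ < 1) (k : ℕ) :
    1 - a * p ^ k ≠ 0 := by
  refine one_sub_ne_zero_of_norm_lt ?_
  rw [norm_mul, norm_pow]
  exact mul_lt_one_of_nonneg_of_lt_one_left (norm_nonneg _) ha
    (pow_le_one₀ (norm_nonneg _) hp.le)

theorem tendsto_qPoch (a : ℂ) {p : ℂ} (hp : ‖p‖ < 1) :
    Tendsto (qPoch a p) atTop (𝓝 (qPochInf a p)) :=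
  (hasProd_qPochInf a hp).tendsto_prod_nat

theorem qPochInf_eq_qPoch_mul (a : ℂ) {p : ℂ} (hp : ‖p‖ < 1) (n : ℕ) :
    qPochInf a p = qPoch a p n * qPochInf (a * p ^ n) p := by
  refine tendsto_nhds_unique ((tendsto_add_atTop_iff_nat n).2 (tendsto_qPoch a hp)) ?_
  simp only [add_comm _ n, qPoch_add]
  exact (tendsto_qPoch _ hp).const_mul _

theorem qPochInf_ne_zero {a p : ℂ} (hp : ‖p‖ < 1) (h : ∀ k : ℕ, 1 - a * p ^ k ≠ 0) :
    qPochInf a p ≠ 0 := by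
  have hs : Summable (fun k : ℕ => ‖-(a * p ^ k)‖) := by
    simp only [norm_neg, norm_mul, norm_pow]
    exact (summable_geometric_of_lt_one (norm_nonneg p) hp).mul_left _
  have := tprod_one_add_ne_zero_of_summable (f := fun k : ℕ => -(a * p ^ k))
    (fun k => by simpa [sub_eq_add_neg] using h k) hs
  simpa [qPochInf, sub_eq_add_neg] using this

theorem exists_norm_qPoch_le (a : ℂ) {p : ℂ} (hp : ‖p‖ < 1) :
    ∃ C : ℝ, 0 < C ∧ ∀ n, ‖qPoch a p n‖ ≤ C := by
  obtain ⟨C, hC⟩ := (tendsto_qPoch a hp).norm.bddAbove_range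
  refine ⟨max C 1, by positivity, fun n => (hC ⟨n, rfl⟩).trans (le_max_left _ _)⟩

theorem exists_le_norm_qPoch {a p : ℂ} (hp : ‖p‖ < 1) (h : ∀ k : ℕ, 1 - a * p ^ k ≠ 0) :
    ∃ δ : ℝ, 0 < δ ∧ ∀ n, δ ≤ ‖qPoch a p n‖ := by
  have ht : Tendsto (fun n => ‖qPoch a p n‖⁻¹) atTop (𝓝 ‖qPochInf a p‖⁻¹) :=
    (tendsto_qPoch a hp).norm.inv₀ (norm_ne_zero_iff.2 (qPochInf_ne_zero hp h))
  obtain ⟨C, hC⟩ := ht.bddAbove_range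
  refine ⟨(max C 1)⁻¹, by positivity, fun n => ?_⟩
  have hn : 0 < ‖qPoch a p n‖ := norm_pos_iff.2 (qPoch_ne_zero h n)
  exact inv_le_of_inv_le₀ hn ((hC ⟨n, rfl⟩).trans (le_max_left _ _))

/-- The shifted symbol is `(a; p)_{N+n} / (a; p)_N`, so one bound serves all `N`; this is what
dominated convergence in `N` needs. -/
theorem exists_le_norm_qPoch_shift {a p : ℂ} (hp : ‖p‖ < 1) (h : ∀ k : ℕ, 1 - a * p ^ k ≠ 0) :
    ∃ δ : ℝ, 0 < δ ∧ ∀ N n, δ ≤ ‖qPoch (a * p ^ N) p n‖ := by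
  obtain ⟨δ, hδ, h1⟩ := exists_le_norm_qPoch hp h
  obtain ⟨C, hC, h2⟩ := exists_norm_qPoch_le a hp
  refine ⟨δ / C, by positivity, fun N n => ?_⟩
  rw [div_le_iff₀ hC]
  calc δ ≤ ‖qPoch a p (N + n)‖ := h1 _
    _ = ‖qPoch (a * p ^ N) p n‖ * ‖qPoch a p N‖ := by rw [qPoch_add, norm_mul, mul_comm]
    _ ≤ _ := by gcongr; exact h2 N

/-! ### The `₁φ₁` summation -/

theorem summable_pow_mul_pow_choose_two {K r : ℝ} (hK : 0 ≤ K) (hr0 : 0 ≤ r) (hr : r < 1) :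
    Summable fun m : ℕ => K ^ m * r ^ m.choose 2 := by
  have ht : Tendsto (fun n : ℕ => K * r ^ n) atTop (𝓝 0) := by
    simpa using (tendsto_pow_atTop_nhds_zero_of_lt_one hr0 hr).const_mul K
  refine summable_of_ratio_norm_eventually_le (r := 1 / 2) (by norm_num) ?_
  filter_upwards [ht.eventually_le_const (show (0 : ℝ) < 1 / 2 by norm_num)] with n hn
  rw [Real.norm_of_nonneg (by positivity), Real.norm_of_nonneg (by positivity),
    Nat.choose_succ_succ' n 1, Nat.choose_one_right, pow_add r, pow_succ K]
  calc K ^ n * K * (r ^ n * r ^ n.choose 2) = (K * r ^ n) * (K ^ n * r ^ n.choose 2) := by ring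
    _ ≤ _ := by gcongr

/-- The terms of the series `₁φ₁(c / b; c; p, b)`, with the division by `b` cleared. -/
noncomputable def phiTerm (b c p : ℂ) (m : ℕ) : ℂ :=
  (∏ j ∈ range m, (c * p ^ j - b)) * p ^ m.choose 2 / (qPoch p p m * qPoch c p m)

theorem norm_prod_sub_le (b c : ℂ) {p : ℂ} (hp : ‖p‖ < 1) (m : ℕ) :
    ‖∏ j ∈ range m, (c * p ^ j - b)‖ ≤ (‖c‖ + ‖b‖) ^ m := by
  rw [norm_prod]
  refine (prod_le_prod (fun _ _ => norm_nonneg _) (g := fun _ => ‖c‖ + ‖b‖)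
    fun j _ => ?_).trans_eq (by simp)
  refine (norm_sub_le _ _).trans ?_
  rw [norm_mul, norm_pow]
  gcongr
  exact mul_le_of_le_one_right (norm_nonneg _) (pow_le_one₀ (norm_nonneg _) hp.le)

theorem exists_norm_phiTerm_shift_le (b : ℂ) {c p : ℂ} (hp : ‖p‖ < 1)
    (hc : ∀ k : ℕ, 1 - c * p ^ k ≠ 0) :
    ∃ C : ℝ, ∀ N m, ‖phiTerm (b * p ^ N) (c * p ^ N) p m‖ ≤
      C * ((‖c‖ + ‖b‖) ^ m * ‖p‖ ^ m.choose 2) := by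
  obtain ⟨δ, hδ, h1⟩ := exists_le_norm_qPoch_shift hp hc
  obtain ⟨ε, hε, h2⟩ := exists_le_norm_qPoch hp (one_sub_mul_pow_ne_zero hp hp)
  refine ⟨(ε * δ)⁻¹, fun N m => ?_⟩
  have hle : ∀ z : ℂ, ‖z * p ^ N‖ ≤ ‖z‖ := fun z => by
    rw [norm_mul, norm_pow]
    exact mul_le_of_le_one_right (norm_nonneg _) (pow_le_one₀ (norm_nonneg _) hp.le)
  rw [phiTerm, norm_div, norm_mul, norm_mul, norm_pow, div_eq_inv_mul]
  gcongr
  · exact h2 m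
  · exact h1 N m
  · refine (norm_prod_sub_le _ _ hp m).trans ?_
    gcongr <;> exact hle _

theorem summable_norm_phiTerm (b : ℂ) {c p : ℂ} (hp : ‖p‖ < 1)
    (hc : ∀ k : ℕ, 1 - c * p ^ k ≠ 0) : Summable fun m => ‖phiTerm b c p m‖ := by
  obtain ⟨C, hC⟩ := exists_norm_phiTerm_shift_le b hp hc
  refine Summable.of_nonneg_of_le (fun _ => norm_nonneg _) (fun m => by simpa using hC 0 m)
    ((summable_pow_mul_pow_choose_two (by positivity) (norm_nonneg p) hp).mul_left C)

/-- Telescoping certificate `G(m) = -(1 - p^m) phiTerm b c p m` for the contiguous relation between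
`(b, c)` and `(bp, cp)`. -/
theorem phiTerm_sub_shift (b : ℂ) {c p : ℂ} (hp : ‖p‖ < 1)
    (hc : ∀ k : ℕ, 1 - c * p ^ k ≠ 0) (m : ℕ) :
    phiTerm b c p m - (1 - b) / (1 - c) * phiTerm (b * p) (c * p) p m =
      (-(phiTerm b c p (m + 1) * (1 - p ^ (m + 1)))) - (-(phiTerm b c p m * (1 - p ^ m))) := by
  have h1 : (1 - c) ≠ 0 := by simpa using hc 0
  have hP := qPoch_ne_zero (one_sub_mul_pow_ne_zero hp hp) m
  have hC := qPoch_ne_zero hc m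
  have hpm : 1 - p * p ^ m ≠ 0 := one_sub_mul_pow_ne_zero hp hp m
  have hcm := hc m
  have e1 : ∏ j ∈ range m, (c * p * p ^ j - b * p) = (∏ j ∈ range m, (c * p ^ j - b)) * p ^ m := by
    rw [← card_range m, ← prod_const, card_range, ← prod_mul_distrib]
    exact prod_congr rfl fun j _ => by ring
  have e2 : qPoch (c * p) p m = qPoch c p m * (1 - c * p ^ m) / (1 - c) := by
    rw [← qPoch_succ, qPoch_succ', mul_div_cancel_left₀ _ h1]
  have e3 : p ^ (m + 1) = p * p ^ m := pow_succ' _ _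
  rw [phiTerm, phiTerm, phiTerm, e1, e2, e3, qPoch_succ, qPoch_succ, prod_range_succ,
    Nat.choose_succ_succ' m 1, Nat.choose_one_right, pow_add]
  generalize p ^ m = s at *
  generalize 1 - p * s = u at *
  field_simp
  ring

/-- The telescoped sum has no boundary terms: `1 - p^m` vanishes at `m = 0`, and the terms tend to
zero at infinity. -/
theorem tsum_phiTerm_shift (b : ℂ) {c p : ℂ} (hp : ‖p‖ < 1)
    (hc : ∀ k : ℕ, 1 - c * p ^ k ≠ 0) :
    ∑' m, phiTerm b c p m = (1 - b) / (1 - c) * ∑' m, phiTerm (b * p) (c * p) p m := by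
  have hc' : ∀ k : ℕ, 1 - c * p * p ^ k ≠ 0 := fun k => by
    simpa [pow_succ', mul_assoc] using hc (k + 1)
  have s1 := (summable_norm_phiTerm b hp hc).of_norm
  have s2 := ((summable_norm_phiTerm (b * p) hp hc').of_norm).mul_left ((1 - b) / (1 - c))
  rw [← sub_eq_zero, ← tsum_mul_left, ← s1.tsum_sub s2]
  have ht : Tendsto (fun m => -(phiTerm b c p m * (1 - p ^ m))) atTop (𝓝 0) := by
    have := (s1.tendsto_atTop_zero.mul
      ((tendsto_pow_atTop_nhds_zero_of_norm_lt_one hp).const_sub 1)).neg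
    simpa using this
  refine tendsto_nhds_unique (s1.sub s2).hasSum.tendsto_sum_nat ?_
  simp only [phiTerm_sub_shift b hp hc, sum_range_sub (fun m => -(phiTerm b c p m * (1 - p ^ m)))]
  simpa using ht

theorem tsum_phiTerm_iterate (b : ℂ) {c p : ℂ} (hp : ‖p‖ < 1)
    (hc : ∀ k : ℕ, 1 - c * p ^ k ≠ 0) (N : ℕ) :
    ∑' m, phiTerm b c p m =
      qPoch b p N / qPoch c p N * ∑' m, phiTerm (b * p ^ N) (c * p ^ N) p m := by
  induction N with
  | zero => simp [qPoch_zero]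
  | succ N ih =>
    rw [ih, tsum_phiTerm_shift _ hp (fun k => by
      simpa [pow_add, mul_assoc] using hc (N + k)), qPoch_succ, qPoch_succ]
    rw [pow_succ, ← mul_assoc b, ← mul_assoc c, ← mul_assoc, div_mul_div_comm]

/-- The `₁φ₁` summation. -/
theorem hasSum_phiTerm (b : ℂ) {c p : ℂ} (hp : ‖p‖ < 1)
    (hc : ∀ k : ℕ, 1 - c * p ^ k ≠ 0) :
    HasSum (phiTerm b c p) (qPochInf b p / qPochInf c p) := by
  have s1 := (summable_norm_phiTerm b hp hc).of_norm
  obtain ⟨C, hC⟩ := exists_norm_phiTerm_shift_le b hp hc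
  have hz : ∀ z : ℂ, Tendsto (fun N : ℕ => z * p ^ N) atTop (𝓝 0) := fun z => by
    simpa using (tendsto_pow_atTop_nhds_zero_of_norm_lt_one hp).const_mul z
  -- Iterating the shift sends both parameters to `0`, where only the term `m = 0` survives.
  have hlim : Tendsto (fun N => ∑' m, phiTerm (b * p ^ N) (c * p ^ N) p m) atTop
      (𝓝 (∑' m, phiTerm 0 0 p m)) := by
    refine tendsto_tsum_of_dominated_convergence
      ((summable_pow_mul_pow_choose_two (K := ‖c‖ + ‖b‖) (by positivity)
        (norm_nonneg p) hp).mul_left C) (fun m => ?_) (.of_forall fun N m => hC N m)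
    have hq : Tendsto (fun N : ℕ => qPoch (c * p ^ N) p m) atTop (𝓝 (qPoch 0 p m)) :=
      tendsto_finsetProd _ fun j _ => ((hz c).mul_const _).const_sub 1
    refine Tendsto.div (Tendsto.mul_const _ ?_) (hq.const_mul _) ?_
    · exact tendsto_finsetProd _ fun j _ => ((hz c).mul_const _).sub (hz b)
    · have := qPoch_ne_zero (one_sub_mul_pow_ne_zero hp hp) m
      simpa [qPoch] using this
  have h0 : ∑' m, phiTerm 0 0 p m = 1 := by
    rw [tsum_eq_single 0 (fun m hm => by simp [phiTerm, hm])]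
    simp [phiTerm, qPoch]
  rw [h0] at hlim
  have := ((tendsto_qPoch b hp).div (tendsto_qPoch c hp) (qPochInf_ne_zero hp hc)).mul hlim
  rw [mul_one] at this
  have h2 := tendsto_nhds_unique this
    (tendsto_const_nhds.congr (tsum_phiTerm_iterate b hp hc))
  rw [h2]
  exact s1.hasSum

/-! ### Coding `P4` by words -/

/-- The residue contribution `1` of an odd part and `2` of an even part. -/
def parityWidth (c : Bool) : ℕ := bif c then 1 else 2

/-- The increasing list of parts, starting above `s`, coded by a word of parities and
multiplicities of the gap `4`. -/
def partsOfCode : ℕ → List (Bool × ℕ) → List ℕ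
  | _, [] => []
  | s, (c, k) :: w => (s + parityWidth c + 4 * k) :: partsOfCode (s + 2 * parityWidth c + 4 * k) w

/-- The code of an increasing list of parts. -/
def codeOfParts : ℕ → List ℕ → List (Bool × ℕ)
  | _, [] => []
  | s, a :: l => (decide (Odd a), (a - s - parityWidth (decide (Odd a))) / 4) ::
      codeOfParts (a + parityWidth (decide (Odd a))) l

/-- The increasing lists which have a code. -/
def IsCoded : ℕ → List ℕ → Prop
  | _, [] => True
  | s, a :: l => s + parityWidth (decide (Odd a)) ≤ a ∧
      a % 4 = (s + parityWidth (decide (Odd a))) % 4 ∧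
      IsCoded (a + parityWidth (decide (Odd a))) l

theorem decide_odd_eq (c : Bool) {s : ℕ} (hs : Even s) (k : ℕ) :
    decide (Odd (s + parityWidth c + 4 * k)) = c := by
  rw [Nat.even_iff] at hs
  cases c <;> simp [parityWidth, Nat.odd_iff] <;> omega

theorem isCoded_partsOfCode (w : List (Bool × ℕ)) {s : ℕ} (hs : Even s) :
    IsCoded s (partsOfCode s w) := by
  induction w generalizing s with
  | nil => trivial
  | cons a w ih =>
    obtain ⟨c, k⟩ := a
    simp only [partsOfCode, IsCoded, decide_odd_eq c hs k]
    refine ⟨by omega, by omega, ?_⟩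
    rw [show s + parityWidth c + 4 * k + parityWidth c = s + 2 * parityWidth c + 4 * k by ring]
    refine ih ?_
    rw [Nat.even_iff] at hs ⊢
    omega

theorem codeOfParts_partsOfCode (w : List (Bool × ℕ)) {s : ℕ} (hs : Even s) :
    codeOfParts s (partsOfCode s w) = w := by
  induction w generalizing s with
  | nil => rfl
  | cons a w ih =>
    obtain ⟨c, k⟩ := a
    simp only [partsOfCode, codeOfParts, decide_odd_eq c hs k]
    rw [show s + parityWidth c + 4 * k + parityWidth c = s + 2 * parityWidth c + 4 * k by ring, ih]
    · congr 2
      omega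
    · rw [Nat.even_iff] at hs ⊢
      omega

theorem partsOfCode_codeOfParts (l : List ℕ) {s : ℕ} (h : IsCoded s l) :
    partsOfCode s (codeOfParts s l) = l := by
  induction l generalizing s with
  | nil => rfl
  | cons a l ih =>
    obtain ⟨h1, h2, h3⟩ := h
    simp only [codeOfParts, partsOfCode]
    generalize parityWidth (decide (Odd a)) = t at *
    have e : s + t + 4 * ((a - s - t) / 4) = a := by omega
    rw [e, show s + 2 * t + 4 * ((a - s - t) / 4) = a + t by omega, ih h3]

/-- The residues 2, 0, 3 are the sums of widths 1 + 1, 2 + 2, 1 + 2 modulo 4; strictness makes the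
difference at least that sum, excluding 0 for two even parts. -/
theorem p4Gap_iff (a b : ℕ) : P4Gap b a ↔
    a + parityWidth (decide (Odd a)) + parityWidth (decide (Odd b)) ≤ b ∧
      b % 4 = (a + parityWidth (decide (Odd a)) + parityWidth (decide (Odd b))) % 4 := by
  constructor
  · rintro ⟨h1, h2, h3, h4⟩
    simp only [Nat.odd_iff, Nat.even_iff, Int.ModEq] at h2 h3 h4 ⊢
    by_cases ha : a % 2 = 1 <;> by_cases hb : b % 2 = 1 <;>
      simp [ha, hb, parityWidth] <;> omega
  · rintro ⟨h1, h2⟩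
    simp only [Nat.odd_iff] at h1 h2
    by_cases ha : a % 2 = 1 <;> by_cases hb : b % 2 = 1 <;>
      simp [ha, hb, parityWidth] at h1 h2 <;> constructor <;>
      (try simp only [Nat.odd_iff, Nat.even_iff, Int.ModEq]) <;> intros <;> omega

theorem isCoded_iff_isChain (l : List ℕ) (a : ℕ) :
    IsCoded (a + parityWidth (decide (Odd a))) l ↔ (a :: l).IsChain (fun a b => P4Gap b a) := by
  induction l generalizing a with
  | nil => simp [IsCoded]
  | cons b l ih =>
    rw [List.isChain_cons_cons, ← ih, p4Gap_iff, IsCoded, and_assoc]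

theorem isCoded_zero_iff (l : List ℕ) : IsCoded 0 l ↔
    l.IsChain (fun a b => P4Gap b a) ∧ ∀ s ∈ l.head?, s ≡ 1 [MOD 4] ∨ s ≡ 2 [MOD 4] := by
  cases l with
  | nil => simp [IsCoded]
  | cons a l =>
    rw [IsCoded, ← isCoded_iff_isChain, ← and_assoc, and_comm]
    refine and_congr Iff.rfl ?_
    simp only [List.head?_cons, Option.mem_some_iff, forall_eq', Nat.ModEq, Nat.odd_iff]
    by_cases ha : a % 2 = 1 <;> simp [ha, parityWidth] <;> omega

theorem IntPartition.ext_parts {p p' : IntPartition} (h : p.2.parts = p'.2.parts) : p = p' := by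
  obtain ⟨n, p⟩ := p
  obtain ⟨n', p'⟩ := p'
  obtain rfl : n = n' := by rw [← p.parts_sum, ← p'.parts_sum]; exact congrArg _ h
  exact congrArg _ (Nat.Partition.ext h)

theorem mem_P4_iff (p : IntPartition) : p ∈ P4 ↔ IsCoded 0 p.partList.reverse := by
  rw [isCoded_zero_iff, List.isChain_reverse, List.head?_reverse]
  rfl

theorem IsCoded.lt_of_mem {l : List ℕ} {s : ℕ} (h : IsCoded s l) : ∀ a ∈ l, s < a := by
  have hpos : ∀ c, 0 < parityWidth c := by decide
  induction l generalizing s with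
  | nil => simp
  | cons b l ih =>
    obtain ⟨h1, -, h3⟩ := h
    have := hpos (decide (Odd b))
    simp only [List.mem_cons, forall_eq_or_imp]
    exact ⟨by omega, fun a ha => by have := ih h3 a ha; omega⟩

theorem IsCoded.pairwise {l : List ℕ} {s : ℕ} (h : IsCoded s l) : l.Pairwise (· ≤ ·) := by
  induction l generalizing s with
  | nil => simp
  | cons b l ih =>
    rw [List.pairwise_cons]
    exact ⟨fun a ha => by have := h.2.2.lt_of_mem a ha; omega, ih h.2.2⟩

/-- The partition whose parts are the entries of a list of positive numbers. -/
def IntPartition.ofList (l : List ℕ) (h : ∀ a ∈ l, 0 < a) : IntPartition :=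
  ⟨l.sum, ⟨l, fun hi => h _ hi, rfl⟩⟩

theorem IntPartition.partList_ofList {l : List ℕ} (h : IsCoded 0 l) :
    (IntPartition.ofList l h.lt_of_mem).partList = l.reverse := by
  refine List.Perm.eq_of_pairwise' (r := (· ≥ ·)) (Multiset.pairwise_sort _ _) ?_ ?_
  · simpa [List.pairwise_reverse] using h.pairwise
  · refine List.Perm.trans ?_ (List.reverse_perm l).symm
    exact Multiset.coe_eq_coe.1 (Multiset.sort_eq _ _)

/-- Words of parities and gaps code the partitions in `P4`. -/
def codeEquivP4 : List (Bool × ℕ) ≃ P4 where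
  toFun w := ⟨IntPartition.ofList (partsOfCode 0 w) (isCoded_partsOfCode w Even.zero).lt_of_mem, by
    have h := isCoded_partsOfCode w (s := 0) Even.zero
    rw [mem_P4_iff, IntPartition.partList_ofList h, List.reverse_reverse]
    exact h⟩
  invFun p := codeOfParts 0 p.1.partList.reverse
  left_inv w := by
    have h := isCoded_partsOfCode w (s := 0) Even.zero
    simp only [IntPartition.partList_ofList h, List.reverse_reverse]
    exact codeOfParts_partsOfCode w Even.zero
  right_inv p := by
    refine Subtype.ext (IntPartition.ext_parts ?_)
    have h := (mem_P4_iff p.1).1 p.2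
    simp only [IntPartition.ofList, partsOfCode_codeOfParts _ h]
    rw [Multiset.coe_reverse]
    exact Multiset.sort_eq _ _

/-! ### The generating function by number of parts -/

section GeneratingFunction

variable {R : Type*} [CommRing R]

/-- The weight of a list of parts, in which an odd part `a` counts `x * q ^ a` and an even one
`y * q ^ a`. -/
def listWeight (x y q : R) (l : List ℕ) : R :=
  (l.map fun a => (bif decide (Odd a) then x else y) * q ^ a).prod

theorem weight_eq_listWeight (x y q : ℂ) (w : List (Bool × ℕ)) :
    x ^ (codeEquivP4 w).1.oddCount * y ^ (codeEquivP4 w).1.evenCount * q ^ (codeEquivP4 w).1.size =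
      listWeight x y q (partsOfCode 0 w) := by
  change x ^ (Multiset.countP _ (partsOfCode 0 w : Multiset ℕ)) *
    y ^ (Multiset.countP _ (partsOfCode 0 w : Multiset ℕ)) * q ^ (partsOfCode 0 w).sum = _
  generalize partsOfCode 0 w = l
  simp only [Multiset.coe_countP, listWeight]
  induction l with
  | nil => simp
  | cons a l ih =>
    rw [List.map_cons, List.prod_cons, ← ih, List.sum_cons, pow_add]
    by_cases ha : Odd a
    · have ha' : ¬ Even a := Nat.not_even_iff_odd.2 ha
      simp [ha, ha', pow_succ]
      ring
    · have ha' : Even a := Nat.not_odd_iff_even.1 ha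
      simp [ha, ha', pow_succ]
      ring

theorem listWeight_partsOfCode_shift (x y q : R) (w : List (Bool × ℕ)) {s : ℕ} (hs : Even s)
    (t : ℕ) (ht : Even t) : listWeight x y q (partsOfCode (s + t) w) =
      q ^ (t * w.length) * listWeight x y q (partsOfCode s w) := by
  induction w generalizing s with
  | nil => simp [partsOfCode, listWeight]
  | cons a w ih =>
    obtain ⟨c, k⟩ := a
    have hs' : Even (s + 2 * parityWidth c + 4 * k) := by
      rw [Nat.even_iff] at *
      omega
    simp only [listWeight, partsOfCode, List.map_cons, List.prod_cons, List.length_cons,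
      decide_odd_eq c hs k, decide_odd_eq c (hs.add ht) k] at ih ⊢
    rw [show s + t + 2 * parityWidth c + 4 * k = s + 2 * parityWidth c + 4 * k + t by ring,
      ih hs']
    ring

/-- A new smallest part of width `t` with multiple `k` raises every later part by the even number
`2t + 4k`, which preserves parities. -/
theorem listWeight_partsOfCode_cons (x y q : R) (c : Bool) (k : ℕ) (w : List (Bool × ℕ)) :
    listWeight x y q (partsOfCode 0 ((c, k) :: w)) =
      ((bif c then x else y) * q ^ (parityWidth c * (2 * w.length + 1)) *
        (q ^ (4 * (w.length + 1))) ^ k) * listWeight x y q (partsOfCode 0 w) := by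
  have h : listWeight x y q (partsOfCode 0 ((c, k) :: w)) =
      (bif c then x else y) * q ^ (0 + parityWidth c + 4 * k) *
        listWeight x y q (partsOfCode (0 + (2 * parityWidth c + 4 * k)) w) := by
    simp only [listWeight, partsOfCode, List.map_cons, List.prod_cons,
      decide_odd_eq c Even.zero k]
    simp only [add_assoc]
  rw [h, listWeight_partsOfCode_shift _ _ _ _ Even.zero _ (by rw [Nat.even_iff]; omega)]
  ring

end GeneratingFunction

/-- The generating function of the partitions in `P4` with `n` parts. -/
noncomputable def genFun {𝕜 : Type*} [Field 𝕜] (x y q : 𝕜) (n : ℕ) : 𝕜 :=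
  ∏ j ∈ range n, (x * q ^ (2 * j + 1) + y * q ^ (2 * (2 * j + 1))) / (1 - q ^ (4 * (j + 1)))

/-- Induction on the number of parts: the smallest part contributes a sum over two parities times a
geometric series in its multiple of 4. Norm summability is carried along to justify multiplying the
series. -/
theorem hasSum_listWeight_ofFn {𝕜 : Type*} [RCLike 𝕜] (x y : 𝕜) {q : 𝕜} (hq : ‖q‖ < 1) (n : ℕ) :
    (Summable fun v : Fin n → Bool × ℕ => ‖listWeight x y q (partsOfCode 0 (List.ofFn v))‖) ∧
    HasSum (fun v : Fin n → Bool × ℕ => listWeight x y q (partsOfCode 0 (List.ofFn v)))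
      (genFun x y q n) := by
  induction n with
  | zero =>
    refine ⟨Summable.of_finite, ?_⟩
    simp [genFun, partsOfCode, listWeight]
  | succ n ih =>
    let f : Bool → 𝕜 := fun c => (bif c then x else y) * q ^ (parityWidth c * (2 * n + 1))
    have hr : ‖q ^ (4 * (n + 1))‖ < 1 := by
      rw [norm_pow]
      exact pow_lt_one₀ (norm_nonneg _) hq (by omega)
    have hf : Summable fun c => ‖f c‖ := Summable.of_finite
    have hg : Summable fun k : ℕ => ‖(q ^ (4 * (n + 1))) ^ k‖ := by
      simp only [norm_pow _ (_ : ℕ)] at hr ⊢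
      exact summable_geometric_of_lt_one (by positivity) hr
    have hfg := hf.mul_norm hg
    have hF : HasSum f (x * q ^ (2 * n + 1) + y * q ^ (2 * (2 * n + 1))) := by
      convert hasSum_fintype f using 1
      simp [f, parityWidth]
    have h1 := hF.mul (hasSum_geometric_of_norm_lt_one hr) hfg.of_norm
    have h3 := hfg.mul_norm ih.1
    have h2 := h1.mul ih.2 h3.of_norm
    have key : ∀ z : (Bool × ℕ) × (Fin n → Bool × ℕ),
        listWeight x y q (partsOfCode 0 (List.ofFn (Fin.consEquiv (fun _ => Bool × ℕ) z))) =
        f z.1.1 * (q ^ (4 * (n + 1))) ^ z.1.2 * listWeight x y q (partsOfCode 0 (List.ofFn z.2)) := by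
      rintro ⟨⟨c, k⟩, v⟩
      simp only [Fin.consEquiv, Equiv.coe_fn_mk, List.ofFn_cons, listWeight_partsOfCode_cons,
        List.length_ofFn, f]
    constructor
    · rw [← (Fin.consEquiv (fun _ : Fin (n + 1) => Bool × ℕ)).summable_iff]
      simpa only [Function.comp_def, key] using h3
    · rw [← (Fin.consEquiv (fun _ : Fin (n + 1) => Bool × ℕ)).hasSum_iff]
      simp only [Function.comp_def, key]
      have e : genFun x y q (n + 1) = (x * q ^ (2 * n + 1) + y * q ^ (2 * (2 * n + 1))) *
          (1 - q ^ (4 * (n + 1)))⁻¹ * genFun x y q n := by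
        rw [genFun, prod_range_succ, mul_comm, div_eq_mul_inv]
        rfl
      rw [e]
      exact h2

/-- Absolute convergence thus reduces to the same product formula over `ℝ`. -/
theorem norm_listWeight (x y q : ℂ) (l : List ℕ) :
    ‖listWeight x y q l‖ = listWeight ‖x‖ ‖y‖ ‖q‖ l := by
  induction l with
  | nil => simp [listWeight]
  | cons a l ih =>
    simp only [listWeight, List.map_cons, List.prod_cons] at ih ⊢
    rw [norm_mul, ih, norm_mul, norm_pow]
    cases decide (Odd a) <;> rfl

theorem summable_genFun_norm (x y : ℂ) {q : ℂ} (hq : ‖q‖ < 1) :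
    Summable (genFun ‖x‖ ‖y‖ ‖q‖) := by
  have ht : Tendsto (fun n : ℕ => (‖x‖ * ‖q‖ ^ (2 * n + 1) + ‖y‖ * ‖q‖ ^ (2 * (2 * n + 1))) /
      (1 - ‖q‖ ^ (4 * (n + 1)))) atTop (𝓝 ((‖x‖ * 0 + ‖y‖ * 0) / (1 - 0))) := by
    have h := tendsto_pow_atTop_nhds_zero_of_lt_one (norm_nonneg q) hq
    have h' : ∀ g : ℕ → ℕ, (∀ n, n ≤ g n) → Tendsto (fun n => ‖q‖ ^ g n) atTop (𝓝 0) :=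
      fun g hg => h.comp (tendsto_atTop_mono hg tendsto_id)
    refine Tendsto.div (((h' _ fun n => ?_).const_mul _).add ((h' _ fun n => ?_).const_mul _))
      ((h' _ fun n => ?_).const_sub _) (by norm_num) <;> omega
  refine summable_of_ratio_norm_eventually_le (r := 1 / 2) (by norm_num) ?_
  have ht' := ht.norm
  simp only [mul_zero, add_zero, zero_div, norm_zero] at ht'
  filter_upwards [ht'.eventually_le_const (show (0 : ℝ) < 1 / 2 by norm_num)] with n hn
  rw [genFun, prod_range_succ, norm_mul, mul_comm]
  gcongr
  rfl

/-- The generating function of `P4`. -/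
theorem hasSum_P4 (x y : ℂ) {q : ℂ} (hq : ‖q‖ < 1) {S : ℂ} (hS : HasSum (genFun x y q) S) :
    HasSum (fun p : P4 => x ^ p.1.oddCount * y ^ p.1.evenCount * q ^ p.1.size) S := by
  rw [← codeEquivP4.hasSum_iff]
  simp only [Function.comp_def, weight_eq_listWeight]
  -- Words are grouped by length, that is, by the number of parts.
  rw [← List.equivSigmaTuple.symm.hasSum_iff]
  refine HasSum.sigma_of_hasSum hS (fun n => (hasSum_listWeight_ofFn x y hq n).2) ?_
  refine Summable.of_norm ?_
  have hq' : ‖‖q‖‖ < 1 := by rwa [norm_norm]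
  simp only [Function.comp_def, norm_listWeight]
  rw [summable_sigma_of_nonneg (fun v => by rw [← norm_listWeight]; exact norm_nonneg _)]
  refine ⟨fun n => (hasSum_listWeight_ofFn ‖x‖ ‖y‖ hq' n).2.summable,
    (summable_genFun_norm x y hq).congr fun n => ?_⟩
  exact (hasSum_listWeight_ofFn ‖x‖ ‖y‖ hq' n).2.tsum_eq.symm

/-! ### A Bailey pair relative to `y` -/

/-- The auxiliary factor of the Bailey pair relative to `y`. -/
noncomputable def baileyGamma (y p : ℂ) (k : ℕ) : ℂ :=
  (-1) ^ (k + 1) * p ^ (k + 1) ^ 2 * (1 + y) * qPoch (y ^ 2 * p ^ 2) (p ^ 2) k /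
    qPoch (p ^ 2) (p ^ 2) k

/-- The sequence `α` of the Bailey pair relative to `y` with `βₙ = 1 / (p²; p²)ₙ`. -/
noncomputable def baileyAlpha (y p : ℂ) : ℕ → ℂ
  | 0 => 1
  | k + 1 => baileyGamma y p k * (1 - y * p ^ (2 * (k + 1))) / (1 - p ^ (2 * (k + 1)))

theorem one_sub_pow_ne_zero {p : ℂ} (hp : ‖p‖ < 1) {n : ℕ} (hn : n ≠ 0) : 1 - p ^ n ≠ 0 :=
  one_sub_ne_zero_of_norm_lt (by
    rw [norm_pow]
    exact pow_lt_one₀ (norm_nonneg _) hp hn)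

theorem norm_sq_lt_one {p : ℂ} (hp : ‖p‖ < 1) : ‖p ^ 2‖ < 1 := by
  rw [norm_pow]
  exact pow_lt_one₀ (norm_nonneg _) hp two_ne_zero

theorem baileyGamma_succ (y : ℂ) {p : ℂ} (k : ℕ) :
    baileyGamma y p (k + 1) = -(baileyGamma y p k * p ^ (2 * k + 3) *
      (1 - y ^ 2 * p ^ (2 * (k + 1)))) / (1 - p ^ (2 * (k + 1))) := by
  rw [baileyGamma, baileyGamma, qPoch_succ, qPoch_succ,
    show y ^ 2 * p ^ 2 * (p ^ 2) ^ k = y ^ 2 * p ^ (2 * (k + 1)) by ring,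
    show p ^ 2 * (p ^ 2) ^ k = p ^ (2 * (k + 1)) by ring,
    show (k + 1 + 1) ^ 2 = (k + 1) ^ 2 + (2 * k + 3) by ring, pow_add p, pow_succ (-1 : ℂ) (k + 1)]
  field_simp

/-- Multiplied by `(p²; p²)_n`, the Bailey sum should not depend on `n`. Its increment from `n = k +
d` to `n + 1`, truncated at `r ≤ k`, has a closed form, proved by induction on `k` with `n` fixed.
-/
theorem sum_baileyAlpha_sub {y p : ℂ} (hp : ‖p‖ < 1) (hy : ∀ k : ℕ, 1 - y * p * p ^ k ≠ 0)
    (k d : ℕ) :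
    ∑ r ∈ range (k + 1), baileyAlpha y p r *
      (qPoch (p ^ 2) (p ^ 2) (k + d + 1) / (qPoch p p (k + d + 1 - r) *
          qPoch (y * p) p (k + d + 1 + r)) -
        qPoch (p ^ 2) (p ^ 2) (k + d) / (qPoch p p (k + d - r) * qPoch (y * p) p (k + d + r))) =
    -(p ^ d * baileyGamma y p k * qPoch (p ^ 2) (p ^ 2) (k + d)) /
      (qPoch p p d * qPoch (y * p) p (2 * k + d + 1)) := by
  have hP := qPoch_ne_zero (one_sub_mul_pow_ne_zero hp hp)
  have hY := qPoch_ne_zero hy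
  induction k generalizing d with
  | zero =>
    have hd := one_sub_mul_pow_ne_zero hp hp d
    have hyd := hy d
    have h1 := hP d
    have h2 := hY d
    simp only [zero_add, range_one, sum_singleton, baileyAlpha, one_mul, Nat.sub_zero, add_zero,
      mul_zero, baileyGamma, qPoch_zero, qPoch_succ (p ^ 2) (p ^ 2) d, qPoch_succ p p d,
      qPoch_succ (y * p) p d]
    have e : p ^ 2 * (p ^ 2) ^ d = (p * p ^ d) ^ 2 := by ring
    rw [e]
    generalize p ^ d = D at *
    have h3 : 1 - (p * D) ^ 2 = (1 - p * D) * (1 + p * D) := by ring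
    rw [h3]
    generalize hu : 1 - p * D = u at *
    generalize hv : 1 - y * p * D = v at *
    field_simp
    rw [← hv]
    ring
  | succ k ih =>
    have h := ih (d + 1)
    rw [show k + (d + 1) = k + 1 + d by ring] at h
    rw [sum_range_succ, h, show k + 1 + d + 1 - (k + 1) = d + 1 by omega,
      show k + 1 + d - (k + 1) = d by omega,
      show k + 1 + d + 1 + (k + 1) = 2 * k + d + 2 + 1 by ring,
      show k + 1 + d + (k + 1) = 2 * k + d + 2 by ring,
      show 2 * k + (d + 1) + 1 = 2 * k + d + 2 by ring,
      show 2 * (k + 1) + d + 1 = 2 * k + d + 2 + 1 by ring]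
    have hk : 1 - p ^ (2 * (k + 1)) ≠ 0 := one_sub_pow_ne_zero hp (by omega)
    have hd := one_sub_mul_pow_ne_zero hp hp d
    have hyd := hy (2 * k + d + 2)
    have h1 := hP d
    have h2 := hY (2 * k + d + 2)
    rw [baileyGamma_succ, baileyAlpha, qPoch_succ _ _ (k + 1 + d), qPoch_succ p p d,
      qPoch_succ (y * p) p (2 * k + d + 2)]
    have e1 : p ^ 2 * (p ^ 2) ^ (k + 1 + d) = p ^ (2 * (k + 1)) * (p * p ^ d) ^ 2 := by ring
    have e2 : y * p * p ^ (2 * k + d + 2) = y * p * (p ^ (2 * (k + 1)) * p ^ d) := by ring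
    have e3 : p ^ (2 * k + 3) = p * p ^ (2 * (k + 1)) := by ring
    have e4 : p ^ (d + 1) = p * p ^ d := by ring
    rw [e2] at hyd
    rw [e1, e2, e3, e4]
    generalize p ^ (2 * (k + 1)) = s at *
    generalize p ^ d = D at *
    generalize hu : 1 - p * D = u at *
    generalize hv : 1 - y * p * (s * D) = v at *
    generalize hw : 1 - s = w at *
    field_simp
    rw [← hv, ← hw, ← hu]
    ring

/-- The Bailey pair relation. -/
theorem sum_baileyAlpha {y p : ℂ} (hp : ‖p‖ < 1) (hy : ∀ k : ℕ, 1 - y * p * p ^ k ≠ 0) (n : ℕ) :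
    ∑ r ∈ range (n + 1), baileyAlpha y p r / (qPoch p p (n - r) * qPoch (y * p) p (n + r)) =
      1 / qPoch (p ^ 2) (p ^ 2) n := by
  have hp2 := norm_sq_lt_one hp
  have hQ := qPoch_ne_zero (one_sub_mul_pow_ne_zero hp2 hp2)
  have hY := qPoch_ne_zero hy
  suffices h : ∑ r ∈ range (n + 1), baileyAlpha y p r *
      (qPoch (p ^ 2) (p ^ 2) n / (qPoch p p (n - r) * qPoch (y * p) p (n + r))) = 1 by
    rw [eq_div_iff (hQ n), sum_mul, ← h]
    exact sum_congr rfl fun r _ => by ring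
  induction n with
  | zero => simp [baileyAlpha, qPoch_zero]
  | succ n ih =>
    -- At `d = 0` only the new term `r = n + 1` is missing, and it cancels the closed form.
    have h := sum_baileyAlpha_sub hp hy n 0
    simp only [mul_sub, sum_sub_distrib, add_zero, ih, pow_zero, one_mul, qPoch_zero] at h
    rw [sum_range_succ, eq_add_of_sub_eq h, Nat.sub_self, qPoch_zero, one_mul, baileyAlpha,
      show n + 1 + (n + 1) = 2 * n + 1 + 1 by ring, qPoch_succ _ _ n, qPoch_succ _ _ (2 * n + 1)]
    have h1 : 1 - p ^ (2 * (n + 1)) ≠ 0 := one_sub_pow_ne_zero hp (by omega)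
    have h2 := hy (2 * n + 1)
    have h3 := hY (2 * n + 1)
    have e1 : p ^ 2 * (p ^ 2) ^ n = p ^ (2 * (n + 1)) := by ring
    have e2 : y * p * p ^ (2 * n + 1) = y * p ^ (2 * (n + 1)) := by ring
    rw [e2] at h2
    rw [e1, e2]
    field_simp
    ring

/-- The quotient `αₖ₊₁ / (1 + y)` for the Bailey pair relative to `y`. -/
noncomputable def baileyDelta (y p : ℂ) (k : ℕ) : ℂ :=
  (-1) ^ (k + 1) * p ^ (k + 1) ^ 2 *
    (qPoch (y ^ 2 * p ^ 2) (p ^ 2) k * (1 - y * p ^ (2 * (k + 1)))) /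
    qPoch (p ^ 2) (p ^ 2) (k + 1)

theorem baileyAlpha_succ (y : ℂ) {p : ℂ} (hp : ‖p‖ < 1) (k : ℕ) :
    baileyAlpha y p (k + 1) = (1 + y) * baileyDelta y p k := by
  have hp2 := norm_sq_lt_one hp
  rw [baileyAlpha, baileyGamma, baileyDelta, qPoch_succ (p ^ 2),
    show p ^ 2 * (p ^ 2) ^ k = p ^ (2 * (k + 1)) by ring]
  have h3 := qPoch_ne_zero (one_sub_mul_pow_ne_zero hp2 hp2) k
  have h4 : 1 - p ^ (2 * (k + 1)) ≠ 0 := one_sub_pow_ne_zero hp (by omega)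
  field_simp

theorem exists_norm_baileyDelta_le (y : ℂ) {p : ℂ} (hp : ‖p‖ < 1) :
    ∃ A : ℝ, 0 < A ∧ ∀ k, ‖baileyDelta y p k‖ ≤ A := by
  have hp2 := norm_sq_lt_one hp
  obtain ⟨C, hC, h1⟩ := exists_norm_qPoch_le (y ^ 2 * p ^ 2) hp2
  obtain ⟨δ, hδ, h2⟩ := exists_le_norm_qPoch hp2 (one_sub_mul_pow_ne_zero hp2 hp2)
  refine ⟨C * (1 + ‖y‖) / δ, by positivity, fun k => ?_⟩
  have hpow : ∀ n, ‖p‖ ^ n ≤ 1 := fun n => pow_le_one₀ (norm_nonneg _) hp.le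
  have h4 : ‖1 - y * p ^ (2 * (k + 1))‖ ≤ 1 + ‖y‖ := by
    refine (norm_sub_le _ _).trans ?_
    rw [norm_one, norm_mul, norm_pow]
    gcongr
    exact mul_le_of_le_one_right (norm_nonneg _) (hpow _)
  rw [baileyDelta, norm_div]
  gcongr
  · simp only [norm_mul, norm_pow, norm_neg, norm_one, one_pow, one_mul]
    calc _ ≤ 1 * (C * (1 + ‖y‖)) := by
          gcongr
          · exact hpow _
          · exact h1 k
      _ = _ := one_mul _
  · exact h2 _

theorem exists_norm_baileyAlpha_le (y : ℂ) {p : ℂ} (hp : ‖p‖ < 1) :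
    ∃ A : ℝ, 0 < A ∧ ∀ r, ‖baileyAlpha y p r‖ ≤ A := by
  obtain ⟨A, hA, h⟩ := exists_norm_baileyDelta_le y hp
  refine ⟨max 1 (‖1 + y‖ * A), by positivity, fun r => ?_⟩
  cases r with
  | zero => simp [baileyAlpha]
  | succ k =>
    rw [baileyAlpha_succ y hp, norm_mul]
    exact le_max_of_le_right (by gcongr; exact h k)

/-! ### The limiting Bailey lemma -/

/-- The numerator `(c / b; p)ₙ (-b)ⁿ p ^ (n choose 2)`, with the division by `b` cleared. -/
noncomputable def phiNum (b c p : ℂ) (n : ℕ) : ℂ :=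
  (∏ j ∈ range n, (c * p ^ j - b)) * p ^ n.choose 2

theorem choose_add_two (r m : ℕ) : (r + m).choose 2 = r.choose 2 + m.choose 2 + r * m := by
  induction m with
  | zero => simp
  | succ m ih =>
    rw [← add_assoc, Nat.choose_succ_succ' (r + m) 1, ih, Nat.choose_succ_succ' m 1]
    simp only [Nat.choose_one_right]
    ring

/-- The cross term `p^(rm)` of the binomial supplies a factor `p^r` for each of the last `m`
factors, so what remains is a `₁φ₁` numerator. -/
theorem phiNum_add (b c p : ℂ) (r m : ℕ) :
    phiNum b c p (r + m) = phiNum b c p r * phiNum (b * p ^ r) (c * p ^ (2 * r)) p m := by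
  have e : ∏ j ∈ range m, (c * p ^ (2 * r) * p ^ j - b * p ^ r) =
      (∏ j ∈ range m, (c * p ^ (r + j) - b)) * (p ^ r) ^ m := by
    rw [← card_range m, ← prod_const, card_range, ← prod_mul_distrib]
    exact prod_congr rfl fun j _ => by ring
  rw [phiNum, phiNum, phiNum, e, prod_range_add, choose_add_two, pow_add, pow_add, pow_mul]
  ring

theorem norm_phiNum_le (b c : ℂ) {p : ℂ} (hp : ‖p‖ < 1) (n : ℕ) :
    ‖phiNum b c p n‖ ≤ (‖c‖ + ‖b‖) ^ n * ‖p‖ ^ n.choose 2 := by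
  rw [phiNum, norm_mul, norm_pow]
  gcongr
  exact norm_prod_sub_le b c hp n

/-- Since `α` is bounded, dropping `p^(rm)` leaves a product of two convergent series as majorant.
-/
theorem summable_bailey_double (b : ℂ) {y p : ℂ} (hp : ‖p‖ < 1)
    (hy : ∀ k : ℕ, 1 - y * p * p ^ k ≠ 0) :
    Summable fun z : ℕ × ℕ => baileyAlpha y p z.1 * phiNum b (y * p) p (z.1 + z.2) /
      (qPoch p p z.2 * qPoch (y * p) p (2 * z.1 + z.2)) := by
  obtain ⟨A, hA, h1⟩ := exists_norm_baileyAlpha_le y hp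
  obtain ⟨δ, hδ, h2⟩ := exists_le_norm_qPoch hp hy
  obtain ⟨ε, hε, h3⟩ := exists_le_norm_qPoch hp (one_sub_mul_pow_ne_zero hp hp)
  set K := ‖y * p‖ + ‖b‖ with hK
  have hs := summable_pow_mul_pow_choose_two (K := K) (by positivity) (norm_nonneg p) hp
  have hs2 := (hs.mul_of_nonneg hs (fun _ => by positivity) (fun _ => by positivity)).mul_left
    (A / (ε * δ))
  refine Summable.of_norm_bounded hs2 ?_
  rintro ⟨r, m⟩
  dsimp only
  rw [norm_div, norm_mul, norm_mul]
  calc _ ≤ A * ((K ^ r * ‖p‖ ^ r.choose 2) * (K ^ m * ‖p‖ ^ m.choose 2)) / (ε * δ) := by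
        gcongr
        · exact h1 r
        · refine (norm_phiNum_le b _ hp _).trans ?_
          rw [← hK, choose_add_two]
          calc K ^ (r + m) * ‖p‖ ^ (r.choose 2 + m.choose 2 + r * m)
              ≤ K ^ (r + m) * ‖p‖ ^ (r.choose 2 + m.choose 2) := by
                gcongr ?_ * ?_
                exact pow_le_pow_of_le_one (norm_nonneg _) hp.le (by omega)
            _ = _ := by rw [pow_add, pow_add]; ring
        · exact h3 m
        · exact h2 _
    _ = _ := by ring

/-- The limiting case of Bailey's lemma for the Bailey pair above. -/
theorem exists_hasSum_bailey (b : ℂ) {y p : ℂ} (hp : ‖p‖ < 1)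
    (hy : ∀ k : ℕ, 1 - y * p * p ^ k ≠ 0) :
    ∃ S, HasSum (fun n => phiNum b (y * p) p n / qPoch (p ^ 2) (p ^ 2) n) S ∧
      HasSum (fun r => baileyAlpha y p r * phiNum b (y * p) p r * qPochInf (b * p ^ r) p /
        qPochInf (y * p) p) S := by
  obtain ⟨S, hS⟩ := summable_bailey_double b hp hy
  refine ⟨S, ?_, hS.prod_fiberwise fun r => ?_⟩
  · have h := HasAntidiagonal.sigmaAntidiagonalEquivProd.hasSum_iff.2 hS
    have h' := h.sigma fun n => hasSum_fintype _
    convert h' using 2 with n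
    rw [div_eq_mul_one_div, ← sum_baileyAlpha hp hy, mul_sum]
    refine Eq.trans ?_ (Finset.sum_coe_sort (antidiagonal n) fun z : ℕ × ℕ =>
        baileyAlpha y p z.1 * phiNum b (y * p) p (z.1 + z.2) /
          (qPoch p p z.2 * qPoch (y * p) p (2 * z.1 + z.2))).symm
    rw [Nat.sum_antidiagonal_eq_sum_range_succ_mk]
    refine sum_congr rfl fun r hr => ?_
    have hr' : r ≤ n := Nat.lt_succ_iff.1 (mem_range.1 hr)
    dsimp only
    rw [show r + (n - r) = n by omega, show 2 * r + (n - r) = n + r by omega]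
    ring
  · have hc : ∀ k : ℕ, 1 - y * p * p ^ (2 * r) * p ^ k ≠ 0 := fun k => by
      simpa [pow_add, mul_assoc] using hy (2 * r + k)
    -- For fixed `r`, the sum over `m` is a `₁φ₁`.
    have h := (hasSum_phiTerm (b * p ^ r) hp hc).mul_left
      (baileyAlpha y p r * phiNum b (y * p) p r / qPoch (y * p) p (2 * r))
    have e : baileyAlpha y p r * phiNum b (y * p) p r * qPochInf (b * p ^ r) p /
        qPochInf (y * p) p = baileyAlpha y p r * phiNum b (y * p) p r / qPoch (y * p) p (2 * r) *
        (qPochInf (b * p ^ r) p / qPochInf (y * p * p ^ (2 * r)) p) := by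
      rw [qPochInf_eq_qPoch_mul (y * p) hp (2 * r)]
      ring
    rw [e]
    have key : ∀ m, baileyAlpha y p r * phiNum b (y * p) p (r + m) /
        (qPoch p p m * qPoch (y * p) p (2 * r + m)) =
        baileyAlpha y p r * phiNum b (y * p) p r / qPoch (y * p) p (2 * r) *
          phiTerm (b * p ^ r) (y * p * p ^ (2 * r)) p m := fun m => by
      rw [phiNum_add, qPoch_add, phiTerm]
      simp only [phiNum]
      ring
    simp only [key]
    exact h

/-! ### Specialization to `p = q²` and Slater's product -/

theorem phiNum_eq_prod (x y q : ℂ) (n : ℕ) :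
    phiNum (-(x * q)) (y * q ^ 2) (q ^ 2) n =
      ∏ j ∈ range n, (x * q ^ (2 * j + 1) + y * q ^ (2 * (2 * j + 1))) := by
  induction n with
  | zero => simp [phiNum]
  | succ n ih =>
    rw [prod_range_succ, ← ih, phiNum, phiNum, prod_range_succ, Nat.choose_succ_succ' n 1,
      Nat.choose_one_right, pow_add (q ^ 2)]
    ring

theorem qPoch_sq (p : ℂ) (n : ℕ) : qPoch (p ^ 2) (p ^ 2) n = qPoch p p n * qPoch (-p) p n := by
  rw [qPoch, qPoch, qPoch, ← prod_mul_distrib]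
  exact prod_congr rfl fun j _ => by ring

theorem genFun_eq (x y q : ℂ) (n : ℕ) : genFun x y q n =
    phiNum (-(x * q)) (y * q ^ 2) (q ^ 2) n / qPoch ((q ^ 2) ^ 2) ((q ^ 2) ^ 2) n := by
  rw [phiNum_eq_prod, genFun, prod_div_distrib, qPoch]
  congr 1
  exact prod_congr rfl fun j _ => by ring

theorem genFun_eq_qPoch {x : ℂ} (hx : x ≠ 0) (y q : ℂ) (n : ℕ) : genFun x y q n =
    qPoch (-(y * q / x)) (q ^ 2) n * x ^ n * q ^ (n ^ 2) / qPoch (q ^ 4) (q ^ 4) n := by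
  rw [genFun_eq, phiNum_eq_prod]
  congr 1
  · induction n with
    | zero => simp [qPoch]
    | succ n ih =>
      rw [prod_range_succ, ih, qPoch_succ, show (n + 1) ^ 2 = n ^ 2 + (2 * n + 1) by ring,
        pow_add q, pow_succ x]
      field_simp
      ring
  · ring_nf

theorem hasSum_genFun_neg_one (x : ℂ) {q : ℂ} (hq : ‖q‖ < 1) :
    HasSum (genFun x (-1) q) (qPochInf (-(x * q)) (q ^ 2) / qPochInf (-q ^ 2) (q ^ 2)) := by
  have hp := norm_sq_lt_one hq
  have h := hasSum_phiTerm (-(x * q)) (c := -q ^ 2) hp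
    (one_sub_mul_pow_ne_zero (by rwa [norm_neg]) hp)
  have e : phiTerm (-(x * q)) (-q ^ 2) (q ^ 2) = genFun x (-1) q := by
    ext n
    rw [genFun_eq, qPoch_sq, phiTerm, phiNum, neg_one_mul]
  rwa [e] at h

theorem qPochInf_mul_qPochInf_even (a : ℂ) {p : ℂ} (hp : ‖p‖ < 1) :
    qPochInf a (p ^ 2) * qPochInf (a * p) (p ^ 2) = qPochInf a p := by
  have hp2 := norm_sq_lt_one hp
  have h1 := hasProd_qPochInf a hp2
  have h2 := hasProd_qPochInf (a * p) hp2
  refine HasProd.unique (HasProd.even_mul_odd (f := fun k => 1 - a * p ^ k) ?_ ?_)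
    (hasProd_qPochInf a hp)
  · simpa only [pow_mul] using h1
  · have e : ∀ k : ℕ, 1 - a * p ^ (2 * k + 1) = 1 - a * p * (p ^ 2) ^ k := fun k => by ring
    simpa only [e] using h2

/-- Euler's identity `(-p; p)_∞ (p; p²)_∞ = 1`. -/
theorem qPochInf_neg_mul_qPochInf {p : ℂ} (hp : ‖p‖ < 1) :
    qPochInf (-p) p * qPochInf p (p ^ 2) = 1 := by
  have hp2 := norm_sq_lt_one hp
  have h1 := qPochInf_mul_qPochInf_even p hp
  have h2 : qPochInf (p * p) (p ^ 2) = qPochInf p p * qPochInf (-p) p := by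
    have h := tendsto_qPoch (p ^ 2) hp2
    simp only [funext (qPoch_sq p)] at h
    rw [← sq]
    exact tendsto_nhds_unique h ((tendsto_qPoch p hp).mul (tendsto_qPoch (-p) hp))
  have h0 := qPochInf_ne_zero hp (one_sub_mul_pow_ne_zero hp hp)
  rw [h2] at h1
  refine mul_left_cancel₀ h0 ?_
  linear_combination h1

/-- The exponent `3n²` is `2n²` from `p^(n²)` in `α` plus `n²` from the numerator. -/
theorem baileyDelta_mul_phiNum_div {x q : ℂ} (y : ℂ) (hq : ‖q‖ < 1) (hx : x ≠ 0) (k : ℕ) :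
    baileyDelta y (q ^ 2) k * phiNum (-(x * q)) (y * q ^ 2) (q ^ 2) (k + 1) /
      qPoch (-(x * q)) (q ^ 2) (k + 1) = transformedTerm x y q (k + 1) := by
  have h := (genFun_eq x y q (k + 1)).symm.trans (genFun_eq_qPoch hx y q (k + 1))
  have hq4 : ‖q ^ 4‖ < 1 := by
    rw [norm_pow]
    exact pow_lt_one₀ (norm_nonneg _) hq (by norm_num)
  have hQ := qPoch_ne_zero (one_sub_mul_pow_ne_zero hq4 hq4)
  have e4 : (q ^ 2) ^ 2 = q ^ 4 := by ring
  rw [e4, div_left_inj' (hQ _)] at h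
  rw [h, transformedTerm, baileyDelta, e4,
    Nat.add_sub_cancel, show (q ^ 2) ^ (2 * (k + 1)) = q ^ (4 * (k + 1)) by ring,
    show 3 * (k + 1) ^ 2 = 2 * (k + 1) ^ 2 + (k + 1) ^ 2 by ring, pow_add q, pow_mul q 2]
  ring

theorem summable_transformedTerm {x q : ℂ} (y : ℂ) (hq : ‖q‖ < 1) (hx : x ≠ 0)
    (hxq : ∀ k : ℕ, 1 - -(x * q) * (q ^ 2) ^ k ≠ 0) :
    Summable fun n : ℕ => transformedTerm x y q (n + 1) := by
  have hp := norm_sq_lt_one hq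
  obtain ⟨A, hA, h1⟩ := exists_norm_baileyDelta_le y hp
  obtain ⟨δ, hδ, h2⟩ := exists_le_norm_qPoch hp hxq
  have hs := ((summable_nat_add_iff 1).2 (summable_pow_mul_pow_choose_two
    (K := ‖y * q ^ 2‖ + ‖-(x * q)‖) (by positivity) (norm_nonneg (q ^ 2)) hp)).mul_left (A / δ)
  refine Summable.of_norm_bounded hs fun k => ?_
  rw [← baileyDelta_mul_phiNum_div y hq hx, norm_div, norm_mul, div_mul_eq_mul_div]
  gcongr
  · exact h1 k
  · exact norm_phiNum_le _ _ hp _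
  · exact h2 _

theorem slater_product {q : ℂ} (hq : ‖q‖ < 1) :
    qPochInf (-(-1 * q)) (q ^ 2) / qPochInf (-q ^ 2) (q ^ 2) =
      qPochInf q (q ^ 2) * qPochInf (q ^ 2) (q ^ 4) := by
  have hp := norm_sq_lt_one hq
  have h := qPochInf_neg_mul_qPochInf hp
  rw [show (q ^ 2) ^ 2 = q ^ 4 by ring] at h
  rw [neg_one_mul, neg_neg, div_eq_iff (left_ne_zero_of_mul_eq_one h)]
  linear_combination -qPochInf q (q ^ 2) * h

theorem hasSum_genFun {x y q : ℂ} (hq : ‖q‖ < 1) (hx : x ≠ 0)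
    (hxq : ∀ k : ℕ, 1 + x * q ^ (2 * k + 1) ≠ 0) (hyq : ∀ k : ℕ, 1 - y * q ^ (2 * k + 2) ≠ 0) :
    (Summable fun n : ℕ => transformedTerm x y q (n + 1)) ∧
    HasSum (genFun x y q) (qPochInf (-(x * q)) (q ^ 2) / qPochInf (y * q ^ 2) (q ^ 2) *
      (1 + (1 + y) * ∑' n : ℕ, transformedTerm x y q (n + 1))) := by
  have hp := norm_sq_lt_one hq
  have hb : ∀ k : ℕ, 1 - -(x * q) * (q ^ 2) ^ k ≠ 0 := fun k => by
    convert hxq k using 1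
    ring
  have hy : ∀ k : ℕ, 1 - y * q ^ 2 * (q ^ 2) ^ k ≠ 0 := fun k => by
    convert hyq k using 1
    ring
  obtain ⟨S, h1, h2⟩ := exists_hasSum_bailey (-(x * q)) hp hy
  simp only [← genFun_eq] at h1
  set c := qPochInf (-(x * q)) (q ^ 2) / qPochInf (y * q ^ 2) (q ^ 2) with hc
  have hc0 : c ≠ 0 := div_ne_zero (qPochInf_ne_zero hp hb) (qPochInf_ne_zero hp hy)
  have e : ∀ r, baileyAlpha y (q ^ 2) r * phiNum (-(x * q)) (y * q ^ 2) (q ^ 2) r *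
      qPochInf (-(x * q) * (q ^ 2) ^ r) (q ^ 2) / qPochInf (y * q ^ 2) (q ^ 2) =
      c * (baileyAlpha y (q ^ 2) r * phiNum (-(x * q)) (y * q ^ 2) (q ^ 2) r /
        qPoch (-(x * q)) (q ^ 2) r) := fun r => by
    have h := qPoch_ne_zero hb r
    rw [hc, qPochInf_eq_qPoch_mul (-(x * q)) hp r]
    generalize qPoch (-(x * q)) (q ^ 2) r = P at *
    field_simp
  simp only [e] at h2
  have h3 := h2.mul_left c⁻¹
  simp only [inv_mul_cancel_left₀ hc0] at h3
  -- The term `r = 0` is the leading `1`; all later ones carry the factor `1 + y`.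
  have h4 := (hasSum_nat_add_iff' 1).2 h3
  simp only [baileyAlpha_succ y hp, mul_assoc (1 + y), mul_div_assoc (1 + y),
    baileyDelta_mul_phiNum_div y hq hx] at h4
  simp only [range_one, sum_singleton, baileyAlpha, phiNum, qPoch_zero, range_zero, prod_empty,
    Nat.choose_zero_succ, pow_zero, mul_one, div_one] at h4
  refine ⟨summable_transformedTerm y hq hx hb, ?_⟩
  have h5 := h4.tsum_eq
  rw [tsum_mul_left] at h5
  convert h1 using 1
  rw [h5]
  field_simp
  ring

theorem mainTheorem2 (q : ℂ) (hq : ‖q‖ < 1) :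
    -- the transformed form of the generating function of `𝒫₄`
    (∀ x y : ℂ, x ≠ 0 → (∀ k : ℕ, 1 + x * q ^ (2 * k + 1) ≠ 0) →
      (∀ k : ℕ, 1 - y * q ^ (2 * k + 2) ≠ 0) →
      Summable (fun n : ℕ => transformedTerm x y q (n + 1)) ∧
      HasSum (fun p : P4 => x ^ p.1.oddCount * y ^ p.1.evenCount * q ^ p.1.size)
        (qPochInf (-(x * q)) (q ^ 2) / qPochInf (y * q ^ 2) (q ^ 2)
          * (1 + (1 + y) * ∑' n : ℕ, transformedTerm x y q (n + 1)))) ∧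
    -- the case `y = -1`
    (∀ x : ℂ, x ≠ 0 →
      HasSum (fun p : P4 => x ^ p.1.oddCount * (-1) ^ p.1.evenCount * q ^ p.1.size)
        (qPochInf (-(x * q)) (q ^ 2) / qPochInf (-q ^ 2) (q ^ 2)) ∧
      HasSum (fun n : ℕ => qPoch (q / x) (q ^ 2) n * x ^ n * q ^ (n ^ 2) / qPoch (q ^ 4) (q ^ 4) n)
        (qPochInf (-(x * q)) (q ^ 2) / qPochInf (-q ^ 2) (q ^ 2))) ∧
    -- Slater's identity (4), the case `x = y = -1`
    (HasSum (fun p : P4 => (-1) ^ p.1.oddCount * (-1) ^ p.1.evenCount * q ^ p.1.size)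
        (qPochInf q (q ^ 2) * qPochInf (q ^ 2) (q ^ 4)) ∧
      HasSum (fun n : ℕ => (-1) ^ n * qPoch (-q) (q ^ 2) n * q ^ (n ^ 2) / qPoch (q ^ 4) (q ^ 4) n)
        (qPochInf q (q ^ 2) * qPochInf (q ^ 2) (q ^ 4))) := by
  refine ⟨fun x y hx hxq hyq => ?_, fun x hx => ⟨?_, ?_⟩, ?_, ?_⟩
  · have h := hasSum_genFun hq hx hxq hyq
    exact ⟨h.1, hasSum_P4 x y hq h.2⟩
  · exact hasSum_P4 x (-1) hq (hasSum_genFun_neg_one x hq)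
  · have h := hasSum_genFun_neg_one x hq
    simpa only [funext (genFun_eq_qPoch hx (-1) q), neg_one_mul, neg_div, neg_neg] using h
  · rw [← slater_product hq]
    exact hasSum_P4 (-1) (-1) hq (hasSum_genFun_neg_one (-1) hq)
  · rw [← slater_product hq]
    have h := hasSum_genFun_neg_one (-1) hq
    have e : ∀ n, (-1) ^ n * qPoch (-q) (q ^ 2) n * q ^ (n ^ 2) / qPoch (q ^ 4) (q ^ 4) n =
        genFun (-1) (-1) q n := fun n => by
      rw [genFun_eq_qPoch (by norm_num), neg_one_mul, neg_div_neg_eq, div_one,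
        mul_comm (qPoch (-q) (q ^ 2) n)]
    simpa only [e] using h
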